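/- Let $G$ be a finitely generated infinite group and let $K<G$ be a finitely generated subgroup that is commensurated in $G$, i.e. for every $g\in G$ the subgroup $gKg^{-1}\cap K$ has finite index in both $K$ and $gKg^{-1}$. Let $\mathfrak{P}G$ be the power set of $G$, regarded as a vector space over $\mathbb{Z}/2\mathbb{Z}$ under symmetric difference with $G$ acting by left multiplication, let $\mathfrak{F}_KG$ be the subspace of those $A\subseteq G$ with $A\subseteq FK$ for some finite $F\subseteq G$, and suppose that the Kropholler--Roller relative end number $$\widetilde e(G,K):=\dim_{\mathbb{Z}/2\mathbb{Z}}\bigl(\mathfrak{P}G/\mathfrak{F}_KG\bigr)^G$$ equals $1$. Let $\alpha: K\curvearrowright X$ be an action by homeomorphisms on a compact metrizable space $X$ that has a fixed point. Choose any map $L:G/K\to G$ with $L(q)K=q$ for all $q\in G/K$, put $\delta(g,q):=L(gq)^{-1}gL(q)\in K$, and let $G$ act on $Y:=X^{G/K}$, equipped with the product topology, by the coinduced action $$(gy)_{q}:=\alpha\bigl(\delta(g,g^{-1}q)\bigr)\,y_{g^{-1}q}\qquad(g\in G,\ q\in G/K,\ y\in Y).$$ Let $H$ be any countable group, where $G$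 and $H$ carry the discrete topology, and let $c:G\times Y\to H$ be a continuous map with $c(st,y)=c(s,ty)\,c(t,y)$ for all $s,t\in G$ and $y\in Y$. Then there exist a group homomorphism $\phi:G\to H$ and a continuous map $b:Y\to H$ such that $$c(s,y)=b(sy)^{-1}\,\phi(s)\,b(y)\qquad\text{for all } s\in G,\ y\in Y.$$ -/

import Mathlib

/-! ### Commensurated subgroups -/

/-- `K` is commensurated in `G`: for every `g`, the subgroup `g K g⁻¹ ∩ K` has finite index in both
`K` and `g K g⁻¹`. -/
def IsCommensurated {G : Type*} [Group G] (K : Subgroup G) : Prop :=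
  Subgroup.Commensurable.commensurator K = ⊤

/-! ### The Kropholler-Roller relative end number

The power set of `G`, with symmetric difference as addition, is the space `G → ZMod 2`
(a subset corresponds to its indicator function). -/

/-- The action of `G` by left translation on the power set of `G`: the subset `A` is sent to `g A`. -/
def powerSetRep (G : Type*) [Group G] : Representation (ZMod 2) G (G → ZMod 2) where
  toFun g :=
    { toFun := fun f x => f (g⁻¹ * x)
      map_add' := fun _ _ => rfl
      map_smul' := fun _ _ => rfl }
  map_one' := by
    ext f x
    simp
  map_mul' g h := by
    refine LinearMap.ext fun f => funext fun x => ?_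
    simp [mul_assoc]

/-- The subspace of `K`-finite subsets of `G`, i.e. those contained in `F K` for a finite subset `F`
of `G`. -/
def kFinite {G : Type*} [Group G] (K : Subgroup G) : Submodule (ZMod 2) (G → ZMod 2) where
  carrier := {f | ∃ F : Set G, F.Finite ∧ Function.support f ⊆ {x | ∃ s ∈ F, ∃ k ∈ K, x = s * k}}
  zero_mem' := ⟨∅, Set.finite_empty, by simp⟩
  add_mem' := by
    rintro f f' ⟨F, hF, h⟩ ⟨F', hF', h'⟩
    refine ⟨F ∪ F', hF.union hF', fun x hx => ?_⟩
    rcases Function.support_add f f' hx with hx | hx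
    · obtain ⟨s, hs, k, hk, e⟩ := h hx
      exact ⟨s, Or.inl hs, k, hk, e⟩
    · obtain ⟨s, hs, k, hk, e⟩ := h' hx
      exact ⟨s, Or.inr hs, k, hk, e⟩
  smul_mem' := by
    rintro c f ⟨F, hF, h⟩
    exact ⟨F, hF, (Function.support_const_smul_subset c f).trans h⟩

theorem kFinite_le_comap {G : Type*} [Group G] (K : Subgroup G) (g : G) :
    kFinite K ≤ (kFinite K).comap (powerSetRep G g) := by
  rintro f ⟨F, hF, h⟩
  refine ⟨(fun s => g * s) '' F, hF.image _, fun x hx => ?_⟩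
  obtain ⟨s, hs, k, hk, e⟩ := h (show g⁻¹ * x ∈ Function.support f from hx)
  exact ⟨g * s, ⟨s, hs, rfl⟩, k, hk, by rw [mul_assoc, ← e, mul_inv_cancel_left]⟩

/-- The Kropholler-Roller relative end number: the dimension over the field with two elements of the
space of `G`-invariants of (subsets of `G`) modulo (`K`-finite subsets of `G`). -/
noncomputable def relativeEnds {G : Type*} [Group G] (K : Subgroup G) : Cardinal :=
  Module.rank (ZMod 2)
    ((powerSetRep G).quotient (kFinite K) (kFinite_le_comap K)).invariants

/-! ### Coinduced actions -/

/-- A lift `G ⧸ K → G`, i.e. a choice of a representative in every left coset of `K`. -/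
structure CosetLift {G : Type*} [Group G] (K : Subgroup G) where
  /-- the chosen representative -/
  rep : G ⧸ K → G
  rep_spec : ∀ q : G ⧸ K, (rep q : G ⧸ K) = q

/-- The `K`-valued cocycle `δ(g, q) = L(g q)⁻¹ g L(q)` of a lift `L`. -/
def CosetLift.delta {G : Type*} [Group G] {K : Subgroup G} (L : CosetLift K) (g : G) (q : G ⧸ K) :
    K :=
  ⟨(L.rep (g • q))⁻¹ * (g * L.rep q), by
    rw [← QuotientGroup.eq, L.rep_spec, ← smul_eq_mul, ← MulAction.Quotient.smul_coe, L.rep_spec]⟩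

theorem CosetLift.delta_one {G : Type*} [Group G] {K : Subgroup G} (L : CosetLift K) (q : G ⧸ K) :
    L.delta 1 q = 1 := by
  ext
  simp [CosetLift.delta]

theorem CosetLift.delta_mul {G : Type*} [Group G] {K : Subgroup G} (L : CosetLift K) (g h : G)
    (q : G ⧸ K) : L.delta (g * h) q = L.delta g (h • q) * L.delta h q := by
  ext
  simp [CosetLift.delta, mul_smul, mul_assoc]

/-- The space `X^{G/K}` of the coinduced action (formed with the lift `L`). -/
def Coinduced {G : Type*} [Group G] {K : Subgroup G} (_L : CosetLift K) (X : Type*) : Type _ :=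
  G ⧸ K → X

/-- The product topology. -/
instance Coinduced.instTopologicalSpace {G : Type*} [Group G] {K : Subgroup G} (L : CosetLift K)
    (X : Type*) [TopologicalSpace X] : TopologicalSpace (Coinduced L X) :=
  Pi.topologicalSpace

/-- The coinduced action `(g y)_q = δ(g, g⁻¹ q) y_{g⁻¹ q}`. -/
instance Coinduced.instMulAction {G : Type*} [Group G] {K : Subgroup G} (L : CosetLift K)
    (X : Type*) [MulAction K X] : MulAction G (Coinduced L X) where
  smul g y := fun q => L.delta g (g⁻¹ • q) • y (g⁻¹ • q)
  one_smul y := by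
    funext q
    change L.delta 1 ((1 : G)⁻¹ • q) • y ((1 : G)⁻¹ • q) = y q
    rw [L.delta_one, one_smul, inv_one, one_smul]
  mul_smul g h y := by
    funext q
    change L.delta (g * h) ((g * h)⁻¹ • q) • y ((g * h)⁻¹ • q) =
      L.delta g (g⁻¹ • q) • L.delta h (h⁻¹ • g⁻¹ • q) • y (h⁻¹ • g⁻¹ • q)
    rw [L.delta_mul, mul_inv_rev, mul_smul, mul_smul, smul_inv_smul]

/-! ### Continuous cocycles -/

/-- `c : G × Y → H` is a continuous cocycle for the action of `G` on `Y`. -/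
structure IsContinuousCocycle {G Y H : Type*} [Group G] [TopologicalSpace G] [TopologicalSpace Y]
    [MulAction G Y] [Group H] [TopologicalSpace H] (c : G × Y → H) : Prop where
  continuous : Continuous c
  cocycle : ∀ (s t : G) (y : Y), c (s * t, y) = c (s, t • y) * c (t, y)

/-- The cocycle `c` is trivial: it is cohomologous to a group homomorphism `φ : G → H` via a
continuous transfer map `b : Y → H`. -/
def IsTrivialCocycle {G Y H : Type*} [Group G] [TopologicalSpace Y] [MulAction G Y] [Group H]
    [TopologicalSpace H] (c : G × Y → H) : Prop :=
  ∃ (φ : G →* H) (b : Y → H), Continuous b ∧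
    ∀ (s : G) (y : Y), c (s, y) = (b (s • y))⁻¹ * φ s * b y

/-! Let `y₀` be the constant configuration at the fixed point; it is `G`-fixed, so `φ g = c (g, y₀)`
is a homomorphism. The transfer map is the limit `b y = lim (φ g)⁻¹ * c (g, y)` along `coKFinite K`,
taken for `y` differing from `y₀` at finitely many coordinates. The limit exists because of the end
condition. If `y`, `y'` differ only at `d`, then `g • y`, `g • y'` differ only at `g • d`, so
passing from `g` to `s * g` changes `(c (g, y))⁻¹ * c (g, y')` only when `g • d` lies in the finite
set of coordinates seen by the generators. Removing the preimage of that set from the Cayley graph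
leaves a co-`K`-finite component (`exists_joinedOff_mem_coKFinite`), on which the increment is
constant. For almost all `d` this component contains the start `g = 1`, where the increment is
trivial; so `b` depends on finitely many coordinates and extends continuously. Commensuration makes
the filter invariant under `g ↦ g * s`, so the cocycle identity passes to the limit; finite
dependence then gives all `y`. -/

open Filter Function
open scoped Pointwise

/-! ### Relative ends and components of the Cayley graph. -/

section RelativeEnds

variable {G : Type*} [Group G]

/-- The filter of complements of `K`-finite subsets of `G`. -/
def coKFinite (K : Subgroup G) : Filter G :=
  comap (QuotientGroup.mk : G → G ⧸ K) cofinite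

theorem mem_coKFinite_iff {K : Subgroup G} {A : Set G} :
    A ∈ coKFinite K ↔ ((QuotientGroup.mk : G → G ⧸ K) '' Aᶜ).Finite := by
  rw [coKFinite, mem_comap_iff_compl, mem_cofinite, compl_compl]

theorem mem_kFinite_iff {K : Subgroup G} {f : G → ZMod 2} :
    f ∈ kFinite K ↔ ((QuotientGroup.mk : G → G ⧸ K) '' support f).Finite := by
  constructor
  · rintro ⟨F, hF, h⟩
    refine (hF.image (QuotientGroup.mk : G → G ⧸ K)).subset ?_
    rintro _ ⟨x, hx, rfl⟩
    obtain ⟨s, hs, k, hk, rfl⟩ := h hx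
    exact ⟨s, hs, (QuotientGroup.mk_mul_of_mem s hk).symm⟩
  · intro h
    refine ⟨Quotient.out '' ((QuotientGroup.mk : G → G ⧸ K) '' support f), h.image _, ?_⟩
    intro x hx
    refine ⟨_, ⟨_, ⟨x, hx, rfl⟩, rfl⟩, (Quotient.out (x : G ⧸ K))⁻¹ * x, ?_, by simp⟩
    rw [← QuotientGroup.eq, QuotientGroup.out_eq']

theorem one_notMem_kFinite {K : Subgroup G} (hends : relativeEnds K = 1) :
    (1 : G → ZMod 2) ∉ kFinite K := by
  intro h
  have htop : kFinite K = ⊤ := by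
    refine eq_top_iff.2 fun f _ => ?_
    rw [mem_kFinite_iff] at h ⊢
    refine h.subset (Set.image_mono fun x _ => ?_)
    simp
  have : Subsingleton ((G → ZMod 2) ⧸ kFinite K) := by
    rw [htop]; infer_instance
  rw [relativeEnds, rank_subsingleton'] at hends
  exact zero_ne_one hends

theorem infinite_quotient_of_relativeEnds {K : Subgroup G} (hends : relativeEnds K = 1) :
    Infinite (G ⧸ K) := by
  by_contra h
  rw [not_infinite_iff_finite] at h
  exact one_notMem_kFinite hends (mem_kFinite_iff.2 (Set.toFinite _))

theorem coKFinite_neBot {K : Subgroup G} [Infinite (G ⧸ K)] : (coKFinite K).NeBot :=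
  comap_neBot_iff.2 fun t ht => by
    obtain ⟨q, hq⟩ := (show (cofinite : Filter (G ⧸ K)).NeBot from inferInstance).nonempty_of_mem ht
    obtain ⟨g, rfl⟩ := QuotientGroup.mk_surjective q
    exact ⟨g, hq⟩

/-- If the relative end number is `1`, every `K`-almost invariant function is either `K`-finite or
the complement of a `K`-finite function. -/
theorem mem_kFinite_or_of_relativeEnds {K : Subgroup G} (hends : relativeEnds K = 1)
    {f : G → ZMod 2} (hf : ∀ g, powerSetRep G g f - f ∈ kFinite K) :
    f ∈ kFinite K ∨ 1 - f ∈ kFinite K := by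
  set ρ := (powerSetRep G).quotient (kFinite K) (kFinite_le_comap K)
  have hinv : ∀ f' : G → ZMod 2, (∀ g, powerSetRep G g f' - f' ∈ kFinite K) →
      (kFinite K).mkQ f' ∈ ρ.invariants := by
    intro f' hf' g
    exact (Submodule.Quotient.eq _).2 (hf' g)
  have h1 : ∀ g, powerSetRep G g 1 - 1 ∈ kFinite K := by
    intro g
    have : powerSetRep G g 1 - 1 = 0 := sub_eq_zero.2 rfl
    rw [this]; exact zero_mem _
  have hfr : Module.finrank (ZMod 2) ρ.invariants = 1 :=
    Module.rank_eq_one_iff_finrank_eq_one.1 hends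
  -- The class of `G` itself is nonzero, so it spans the one-dimensional space of invariants.
  have hne : (⟨_, hinv 1 h1⟩ : ρ.invariants) ≠ 0 := by
    intro h
    exact one_notMem_kFinite hends
      ((Submodule.Quotient.mk_eq_zero _).1 (congrArg Subtype.val h))
  obtain ⟨a, ha⟩ := (finrank_eq_one_iff_of_nonzero' _ hne).1 hfr ⟨_, hinv f hf⟩
  have ha' : (kFinite K).mkQ (a • 1) = (kFinite K).mkQ f := by
    rw [map_smul]; exact congrArg Subtype.val ha
  have hmem : a • (1 : G → ZMod 2) - f ∈ kFinite K := (Submodule.Quotient.eq _).1 ha'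
  have ha2 : a = 0 ∨ a = 1 := (by decide : ∀ a : ZMod 2, a = 0 ∨ a = 1) a
  rcases ha2 with rfl | rfl
  · left
    simpa using hmem
  · right
    simpa using hmem

/-- If the relative end number is `1`, a subset of `G` almost invariant under left translation by
generators is either `K`-finite or co-`K`-finite. -/
theorem compl_mem_or_mem_coKFinite {K : Subgroup G} (hends : relativeEnds K = 1) {S : Set G}
    (hS : Subgroup.closure S = ⊤) {A : Set G}
    (hA : ∀ s ∈ S, ∀ᶠ x in coKFinite K, s * x ∈ A ↔ x ∈ A) :
    Aᶜ ∈ coKFinite K ∨ A ∈ coKFinite K := by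
  classical
  let f : G → ZMod 2 := A.indicator 1
  have hgen : ∀ s ∈ S, powerSetRep G s⁻¹ f - f ∈ kFinite K := by
    intro s hs
    rw [mem_kFinite_iff]
    refine (mem_coKFinite_iff.1 (hA s hs)).subset (Set.image_mono fun x hx => ?_)
    intro hx'
    apply hx
    change f (s⁻¹⁻¹ * x) - f x = 0
    rw [inv_inv]
    replace hx' : s * x ∈ A ↔ x ∈ A := hx'
    by_cases h : x ∈ A <;> simp [f, hx', h]
  have hinv : ∀ g, powerSetRep G g f - f ∈ kFinite K → powerSetRep G g⁻¹ f - f ∈ kFinite K := by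
    intro g hg
    have := neg_mem (Submodule.mem_comap.1 (kFinite_le_comap K g⁻¹ hg))
    rw [map_sub, ← Module.End.mul_apply, ← map_mul] at this
    simpa using this
  have hall : ∀ g, powerSetRep G g f - f ∈ kFinite K := by
    intro g
    have hg : g ∈ Subgroup.closure S := hS ▸ Subgroup.mem_top g
    induction hg using Subgroup.closure_induction with
    | mem s hs => simpa using hinv _ (hgen s hs)
    | one => simp
    | mul x y _ _ hx hy =>
      have := add_mem (Submodule.mem_comap.1 (kFinite_le_comap K x hy)) hx
      rw [map_sub, ← Module.End.mul_apply, ← map_mul] at this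
      simpa using this
    | inv x _ hx => exact hinv _ hx
  rcases mem_kFinite_or_of_relativeEnds hends hall with h | h
  · left
    rw [mem_kFinite_iff] at h
    rw [mem_coKFinite_iff, compl_compl]
    refine h.subset (Set.image_mono fun x hx => ?_)
    simp [f, hx]
  · right
    rw [mem_kFinite_iff] at h
    rw [mem_coKFinite_iff]
    refine h.subset (Set.image_mono fun x hx => ?_)
    have : x ∉ A := hx
    simp [f, this]

/-- Right translations preserve co-`K`-finite sets if `K` is commensurated. -/
theorem tendsto_mul_right_coKFinite {K : Subgroup G} (hK : IsCommensurated K) (g : G) :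
    Tendsto (· * g) (coKFinite K) (coKFinite K) := by
  -- `K h K` is a finite union of left cosets: the stabilizer in `K` of the coset of `h` is `K ∩ h K
  -- h⁻¹`, of finite index.
  have horb : ∀ h : G, ((fun k : K => ((k : G) * h : G ⧸ K)) '' Set.univ).Finite := by
    intro h
    have hc : h ∈ Subgroup.Commensurable.commensurator K := by
      rw [show Subgroup.Commensurable.commensurator K = ⊤ from hK]; trivial
    rw [Subgroup.Commensurable.commensurator_mem_iff] at hc
    have hfi : ((ConjAct.toConjAct h • K).subgroupOf K).FiniteIndex := ⟨hc.1⟩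
    have := Subgroup.finite_quotient_of_finiteIndex (H := (ConjAct.toConjAct h • K).subgroupOf K)
    rw [Set.image_univ]
    refine (Set.finite_range (Quotient.lift
      (s := QuotientGroup.leftRel ((ConjAct.toConjAct h • K).subgroupOf K))
      (fun k : K => (((k : G) * h : G) : G ⧸ K)) ?_)).subset ?_
    · intro a b hab
      replace hab := QuotientGroup.leftRel_apply.1 hab
      rw [Subgroup.mem_subgroupOf, Subgroup.mem_pointwise_smul_iff_inv_smul_mem] at hab
      refine QuotientGroup.eq.2 ?_
      simpa [ConjAct.smul_def, mul_assoc] using hab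
    · rintro _ ⟨k, rfl⟩
      exact ⟨(QuotientGroup.mk k), rfl⟩
  intro A hA
  rw [mem_coKFinite_iff] at hA
  rw [mem_map, mem_coKFinite_iff]
  have hfin : (⋃ q ∈ (QuotientGroup.mk : G → G ⧸ K) '' Aᶜ,
      (fun p : G ⧸ K => (Quotient.out q) • p) ''
        ((fun k : K => (((k : G) * g⁻¹ : G) : G ⧸ K)) '' Set.univ)).Finite :=
    hA.biUnion fun q _ => (horb g⁻¹).image _
  refine hfin.subset ?_
  rintro _ ⟨x, hx, rfl⟩
  refine Set.mem_biUnion ⟨x * g, hx, rfl⟩ ?_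
  refine ⟨_, ⟨⟨(Quotient.out ((x * g : G) : G ⧸ K))⁻¹ * (x * g), ?_⟩, trivial, rfl⟩, ?_⟩
  · rw [← QuotientGroup.eq, QuotientGroup.out_eq']
  · change ((_ * _ : G) : G ⧸ K) = _
    simp [mul_assoc]

/-- `x` and `y` are joined by a path in the left Cayley graph of `G` with respect to `S` which uses
no edges between two points of the preimage of `E`. -/
def JoinedOff (K : Subgroup G) (S : Set G) (E : Set (G ⧸ K)) : G → G → Prop :=
  Relation.EqvGen fun x y => (x : G ⧸ K) ∉ E ∧ ∃ s ∈ S, y = s * x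

theorem JoinedOff.mul_right {K : Subgroup G} {S : Set G} {E : Set (G ⧸ K)} {x y : G}
    (h : JoinedOff K S E x y) {k : G} (hk : k ∈ K) : JoinedOff K S E (x * k) (y * k) := by
  induction h with
  | rel x y h =>
    obtain ⟨hx, s, hs, rfl⟩ := h
    refine .rel _ _ ⟨?_, s, hs, mul_assoc _ _ _⟩
    rwa [QuotientGroup.mk_mul_of_mem x hk]
  | refl x => exact .refl _
  | symm x y _ ih => exact .symm _ _ ih
  | trans x y z _ _ ih ih' => exact .trans _ _ _ ih ih'

theorem JoinedOff.eq {K : Subgroup G} {S : Set G} {E : Set (G ⧸ K)} {x y : G}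
    (h : JoinedOff K S E x y) {α : Type*} {u : G → α}
    (hu : ∀ s ∈ S, ∀ z : G, (z : G ⧸ K) ∉ E → u (s * z) = u z) : u x = u y := by
  induction h with
  | rel x y h =>
    obtain ⟨hx, s, hs, rfl⟩ := h
    exact (hu s hs x hx).symm
  | refl x => rfl
  | symm x y _ ih => exact ih.symm
  | trans x y z _ _ ih ih' => exact ih.trans ih'

/-- If the relative end number is `1`, then the complement of the preimage of a finite subset of
`G ⧸ K` has a co-`K`-finite connected component. -/
theorem exists_joinedOff_mem_coKFinite {K : Subgroup G} (hends : relativeEnds K = 1) {S : Set G}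
    (hS : Subgroup.closure S = ⊤) (hSinv : ∀ s ∈ S, s⁻¹ ∈ S) {E : Set (G ⧸ K)} (hE : E.Finite) :
    ∃ x : G, {y | JoinedOff K S E x y} ∈ coKFinite K := by
  by_contra! hcon
  -- A generator leaves a component only from points over `E`, so components are almost invariant.
  have hcompl : ∀ x, {y | JoinedOff K S E x y}ᶜ ∈ coKFinite K := by
    intro x
    refine (compl_mem_or_mem_coKFinite hends hS fun s hs => ?_).resolve_right (hcon x)
    have hEv : ∀ᶠ z : G in coKFinite K, (z : G ⧸ K) ∉ E :=
      tendsto_comap.eventually hE.eventually_cofinite_notMem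
    filter_upwards [hEv] with z hz
    have hr : JoinedOff K S E z (s * z) := .rel _ _ ⟨hz, s, hs, rfl⟩
    exact ⟨fun h => .trans _ _ _ h (.symm _ _ hr), fun h => .trans _ _ _ h hr⟩
  -- A component missing the preimage of `E` is closed under all generators, hence is all of `G`.
  have hmeet : ∀ x, ∃ y, JoinedOff K S E x y ∧ (y : G ⧸ K) ∈ E := by
    intro x
    by_contra! hx
    apply hcon x
    have hall : ∀ g : G, ∀ y, JoinedOff K S E x y → JoinedOff K S E x (g * y) := by
      intro g
      have hg : g ∈ Subgroup.closure S := hS ▸ Subgroup.mem_top g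
      induction hg using Subgroup.closure_induction'' with
      | mem s hs => exact fun y hy => .trans _ _ _ hy (.rel _ _ ⟨hx y hy, s, hs, rfl⟩)
      | inv_mem s hs => exact fun y hy => .trans _ _ _ hy (.rel _ _ ⟨hx y hy, _, hSinv s hs, rfl⟩)
      | one => simp
      | mul a b _ _ ha hb =>
        intro y hy
        rw [mul_assoc]
        exact ha _ (hb _ hy)
    refine univ_mem' fun y => ?_
    simpa using hall (y * x⁻¹) x (.refl _)
  -- Up to right translation by `K`, every component is that of a representative of some `q ∈ E`;
  -- finitely many `K`-finite sets would then cover `G ⧸ K`.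
  have hfin : (⋃ q ∈ E, (QuotientGroup.mk : G → G ⧸ K) ''
      {y | JoinedOff K S E (Quotient.out q) y}).Finite := by
    refine hE.biUnion fun q _ => ?_
    simpa using mem_coKFinite_iff.1 (hcompl (Quotient.out q))
  have := infinite_quotient_of_relativeEnds hends
  refine Set.infinite_univ (hfin.subset fun q _ => ?_)
  obtain ⟨x, rfl⟩ := QuotientGroup.mk_surjective q
  obtain ⟨y, hxy, hy⟩ := hmeet x
  have hk : y⁻¹ * Quotient.out (y : G ⧸ K) ∈ K := by
    rw [← QuotientGroup.eq, QuotientGroup.out_eq']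
  refine Set.mem_biUnion hy ⟨x * (y⁻¹ * Quotient.out (y : G ⧸ K)), ?_,
    QuotientGroup.mk_mul_of_mem x hk⟩
  have := hxy.mul_right hk
  rw [mul_inv_cancel_left] at this
  exact .symm _ _ this

end RelativeEnds

/-! ### Finite dependence and the coinduced space. -/

/-- A continuous map from a product of compact spaces to a discrete space depends on finitely many
coordinates only. -/
theorem Continuous.exists_finite_dependsOn {ι : Type*} {X : ι → Type*}
    [∀ i, TopologicalSpace (X i)] [∀ i, CompactSpace (X i)] {Z : Type*} [TopologicalSpace Z]
    [DiscreteTopology Z] {f : (∀ i, X i) → Z} (hf : Continuous f) :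
    ∃ I : Set ι, I.Finite ∧ DependsOn f I := by
  have hloc : ∀ y : ∀ i, X i, ∃ (I : Finset ι) (t : ∀ i, Set (X i)),
      (∀ i, IsOpen (t i)) ∧ y ∈ (I : Set ι).pi t ∧ ∀ z ∈ (I : Set ι).pi t, f z = f y := by
    intro y
    have hopen : IsOpen (f ⁻¹' {f y}) := (isOpen_discrete _).preimage hf
    obtain ⟨I, t, ht, hsub⟩ := isOpen_pi_iff.1 hopen y rfl
    classical
    refine ⟨I, fun i => if i ∈ I then t i else Set.univ, fun i => ?_, fun i hi => ?_,
      fun z hz => hsub fun i hi => ?_⟩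
    · dsimp only
      split_ifs with h
      · exact (ht i h).1
      · exact isOpen_univ
    · have : i ∈ I := hi
      simp [this, (ht i this).2]
    · have h1 : i ∈ I := hi
      simpa [h1] using hz i hi
  choose I t ht hy hI using hloc
  obtain ⟨T, hT⟩ := isCompact_univ.elim_finite_subcover (fun y => (I y : Set ι).pi (t y))
    (fun y => isOpen_set_pi (I y).finite_toSet fun i _ => ht y i)
    (fun y _ => Set.mem_iUnion.2 ⟨y, hy y⟩)
  refine ⟨⋃ y ∈ T, (I y : Set ι), T.finite_toSet.biUnion fun y _ => (I y).finite_toSet, ?_⟩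
  intro z z' hzz'
  obtain ⟨y, hyT, hz⟩ := Set.mem_iUnion₂.1 (hT (Set.mem_univ z))
  rw [hI y z hz, hI y z' fun i hi => ?_]
  rw [← hzz' i (Set.mem_biUnion hyT hi)]
  exact hz i hi

section Coinduced

variable {G : Type*} [Group G] {K : Subgroup G} {L : CosetLift K} {X : Type*}

/-- The constant configuration. -/
def Coinduced.const (L : CosetLift K) (x₀ : X) : Coinduced L X :=
  fun _ => x₀

/-- The configuration agreeing with `y` on `D` and equal to `x₀` elsewhere. -/
noncomputable def Coinduced.truncate (D : Set (G ⧸ K)) (x₀ : X) (y : Coinduced L X) :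
    Coinduced L X :=
  open Classical in fun q => if q ∈ D then y q else x₀

theorem Coinduced.truncate_of_mem {D : Set (G ⧸ K)} {q : G ⧸ K} (h : q ∈ D) (x₀ : X)
    (y : Coinduced L X) : truncate D x₀ y q = y q :=
  if_pos h

theorem Coinduced.truncate_of_notMem {D : Set (G ⧸ K)} {q : G ⧸ K} (h : q ∉ D) (x₀ : X)
    (y : Coinduced L X) : truncate D x₀ y q = x₀ :=
  if_neg h

theorem Coinduced.continuous_truncate [TopologicalSpace X] (D : Set (G ⧸ K)) (x₀ : X) :
    Continuous (Coinduced.truncate (L := L) D x₀) := by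
  refine continuous_pi fun q => ?_
  by_cases h : q ∈ D
  · simp only [Coinduced.truncate_of_mem h]
    exact continuous_apply (A := fun _ : G ⧸ K => X) q
  · simp only [Coinduced.truncate_of_notMem h]
    exact continuous_const

/-- A continuous map from `X^{G/K}` to a discrete space depends on finitely many coordinates. -/
theorem Coinduced.exists_finite_dependsOn [TopologicalSpace X] [CompactSpace X] {Z : Type*}
    [TopologicalSpace Z] [DiscreteTopology Z] {f : Coinduced L X → Z} (hf : Continuous f) :
    ∃ F : Set (G ⧸ K), F.Finite ∧
      ∀ y y' : Coinduced L X, (∀ q ∈ F, y q = y' q) → f y = f y' := by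
  obtain ⟨F, hF, h⟩ := Continuous.exists_finite_dependsOn (X := fun _ : G ⧸ K => X) hf
  exact ⟨F, hF, fun y y' hyy' => h hyy'⟩

variable [MulAction K X]

theorem Coinduced.smul_apply (g : G) (y : Coinduced L X) (q : G ⧸ K) :
    (g • y) q = L.delta g (g⁻¹ • q) • y (g⁻¹ • q) := rfl

theorem Coinduced.continuous_smul [TopologicalSpace X] [ContinuousConstSMul K X] (g : G) :
    Continuous fun y : Coinduced L X => g • y :=
  continuous_pi fun q =>
    (continuous_apply (A := fun _ : G ⧸ K => X) (g⁻¹ • q)).const_smul (L.delta g (g⁻¹ • q))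

theorem Coinduced.smul_const {x₀ : X} (hx₀ : ∀ k : K, k • x₀ = x₀) (g : G) :
    g • Coinduced.const L x₀ = Coinduced.const L x₀ :=
  funext fun _ => hx₀ _

theorem Coinduced.smul_eq_off_finite {x₀ : X} (hx₀ : ∀ k : K, k • x₀ = x₀) {y : Coinduced L X}
    (hy : {q | y q ≠ x₀}.Finite) (g : G) : {q | (g • y) q ≠ x₀}.Finite := by
  refine (hy.image fun q => g • q).subset fun q hq => ⟨g⁻¹ • q, fun h => hq ?_, by simp⟩
  rw [Coinduced.smul_apply, h, hx₀]

end Coinduced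

/-! ### Increments of a cocycle. -/

section Cocycle

variable {G : Type*} [Group G] {K : Subgroup G} {L : CosetLift K} {X : Type*} {H : Type*}
  [Group H] {c : G × Coinduced L X → H}

/-- Coordinates are changed one at a time; the increments multiply telescopically. -/
theorem increment_eq_of_eq_off_finite {C : G ⧸ K → Set G}
    (hC : ∀ d, ∀ y y' : Coinduced L X, (∀ q, q ≠ d → y q = y' q) → ∀ g ∈ C d, ∀ g' ∈ C d,
        (c (g, y))⁻¹ * c (g, y') = (c (g', y))⁻¹ * c (g', y'))
    {I : Set (G ⧸ K)} (hI : I.Finite) (y y' : Coinduced L X) (hyy' : ∀ q, q ∉ I → y q = y' q)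
    {g g' : G} (hg : ∀ d ∈ I, g ∈ C d) (hg' : ∀ d ∈ I, g' ∈ C d) :
    (c (g, y))⁻¹ * c (g, y') = (c (g', y))⁻¹ * c (g', y') := by
  classical
  induction I, hI using Set.Finite.induction_on generalizing y' with
  | empty =>
    obtain rfl : y = y' := funext fun q => hyy' q (Set.notMem_empty q)
    simp
  | @insert a I _ _ ih =>
    let z : Coinduced L X := fun q => if q = a then y q else y' q
    have h1 := ih z (fun q hq => by
      by_cases h : q = a
      · simp [z, h]
      · simpa [z, h] using hyy' q (by simp [h, hq]))
      (fun d hd => hg d (.inr hd)) (fun d hd => hg' d (.inr hd))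
    have h2 := hC a z y' (fun q hq => by simp [z, hq]) g (hg a (.inl rfl)) g' (hg' a (.inl rfl))
    calc (c (g, y))⁻¹ * c (g, y')
        = ((c (g, y))⁻¹ * c (g, z)) * ((c (g, z))⁻¹ * c (g, y')) := by group
      _ = ((c (g', y))⁻¹ * c (g', z)) * ((c (g', z))⁻¹ * c (g', y')) := by rw [h1, h2]
      _ = _ := by group

variable [MulAction K X]

/-- Changing the coordinate `d` of a configuration changes the values of a cocycle by a factor which
is constant on a co-`K`-finite set `C d`, and `C d` contains `1` for almost all `d`. -/
theorem exists_increment_eq_of_eq_off_singleton (hends : relativeEnds K = 1)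
    (hK : IsCommensurated K) {S : Set G} (hS : Subgroup.closure S = ⊤)
    (hSinv : ∀ s ∈ S, s⁻¹ ∈ S) {F : Set (G ⧸ K)} (hF : F.Finite)
    (hc : ∀ (s t : G) (y : Coinduced L X), c (s * t, y) = c (s, t • y) * c (t, y))
    (hcF : ∀ s ∈ S, ∀ y y' : Coinduced L X, (∀ q ∈ F, y q = y' q) → c (s, y) = c (s, y')) :
    ∃ C : G ⧸ K → Set G, (∀ d, C d ∈ coKFinite K) ∧ {d | 1 ∉ C d}.Finite ∧
      ∀ d, ∀ y y' : Coinduced L X, (∀ q, q ≠ d → y q = y' q) → ∀ g ∈ C d, ∀ g' ∈ C d,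
        (c (g, y))⁻¹ * c (g, y') = (c (g', y))⁻¹ * c (g', y') := by
  obtain ⟨x, hx⟩ := exists_joinedOff_mem_coKFinite hends hS hSinv hF
  refine ⟨fun d => {g | JoinedOff K S F x (g * L.rep d)},
    fun d => tendsto_mul_right_coKFinite hK (L.rep d) hx, ?_, ?_⟩
  -- `1 ∈ C d` means that `L.rep d` lies in the large component, which meets all but finitely many
  -- cosets in all their points.
  · refine (mem_coKFinite_iff.1 hx).subset fun d hd => ⟨L.rep d, fun h => hd ?_, L.rep_spec d⟩
    simpa using h
  · intro d y y' hyy' g hg g' hg'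
    have key : ∀ s ∈ S, ∀ z : G, (z : G ⧸ K) ∉ F →
        (c (s * z * (L.rep d)⁻¹, y))⁻¹ * c (s * z * (L.rep d)⁻¹, y') =
          (c (z * (L.rep d)⁻¹, y))⁻¹ * c (z * (L.rep d)⁻¹, y') := by
      intro s hs z hz
      have : c (s, (z * (L.rep d)⁻¹) • y) = c (s, (z * (L.rep d)⁻¹) • y') := by
        refine hcF s hs _ _ fun q hq => ?_
        rw [Coinduced.smul_apply, Coinduced.smul_apply, hyy']
        rintro h
        apply hz
        rw [inv_smul_eq_iff, ← L.rep_spec d, MulAction.Quotient.smul_coe, L.rep_spec d,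
          smul_eq_mul, inv_mul_cancel_right] at h
        rwa [← h]
      rw [mul_assoc s, hc s, hc s, this, mul_inv_rev, mul_assoc, inv_mul_cancel_left]
    have hgg' : JoinedOff K S F (g * L.rep d) (g' * L.rep d) := .trans _ _ _ (.symm _ _ hg) hg'
    simpa using hgg'.eq
      (u := fun z => (c (z * (L.rep d)⁻¹, y))⁻¹ * c (z * (L.rep d)⁻¹, y')) key

end Cocycle

/-! ### Construction of the transfer map. -/

theorem theorem1 {G : Type*} [Group G] [TopologicalSpace G] [DiscreteTopology G]
    [Group.FG G] [Infinite G]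
    (K : Subgroup G) (hKfg : K.FG) (hKcomm : IsCommensurated K) (hends : relativeEnds K = 1)
    {X : Type*} [TopologicalSpace X] [CompactSpace X] [TopologicalSpace.MetrizableSpace X]
    [MulAction K X] [ContinuousConstSMul K X] (hfix : ∃ x₀ : X, ∀ k : K, k • x₀ = x₀)
    (L : CosetLift K)
    {H : Type*} [Group H] [Countable H] [TopologicalSpace H] [DiscreteTopology H]
    (c : G × Coinduced L X → H) (hc : IsContinuousCocycle c) :
    IsTrivialCocycle c := by
  obtain ⟨x₀, hx₀⟩ := hfix
  have hcs : ∀ s, Continuous fun y => c (s, y) := fun s =>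
    hc.continuous.comp (continuous_const.prodMk continuous_id)
  obtain ⟨S, hS, hSfin⟩ := (Group.fg_iff (G := G)).1 inferInstance
  have hT : Subgroup.closure (S ∪ S⁻¹) = ⊤ :=
    top_le_iff.1 (hS ▸ Subgroup.closure_mono Set.subset_union_left)
  have hTinv : ∀ s ∈ S ∪ S⁻¹, s⁻¹ ∈ S ∪ S⁻¹ := by
    rintro s (h | h)
    · exact .inr (by simpa using h)
    · exact .inl h
  choose F hF hFdep using fun s => Coinduced.exists_finite_dependsOn (hcs s)
  obtain ⟨C, hCmem, hD, hC⟩ := exists_increment_eq_of_eq_off_singleton hends hKcomm hT hTinv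
    ((hSfin.union hSfin.inv).biUnion fun s _ => hF s) hc.cocycle
    (fun s hs y y' h => hFdep s y y' fun q hq => h q (Set.mem_biUnion hs hq))
  have := infinite_quotient_of_relativeEnds hends
  have hne : (coKFinite K).NeBot := coKFinite_neBot
  set D := {d | 1 ∉ C d}
  have hone : ∀ y, c (1, y) = 1 := fun y => by simpa using hc.cocycle 1 1 y
  let y₀ := Coinduced.const L x₀
  let φ : G →* H := MonoidHom.mk' (fun g => c (g, y₀)) fun s t => by
    rw [hc.cocycle, Coinduced.smul_const hx₀]
  have hCD : ∀ {I : Set (G ⧸ K)}, I.Finite → ∀ᶠ g in coKFinite K, ∀ d ∈ I, g ∈ C d :=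
    fun hI => (eventually_all_finite hI).2 fun d _ => hCmem d
  obtain ⟨g₀, hg₀⟩ := (hCD hD).exists
  -- The limit is already attained at `g₀` once the coordinates outside `D` are reset to `x₀`.
  let b : Coinduced L X → H := fun y => (φ g₀)⁻¹ * c (g₀, Coinduced.truncate D x₀ y)
  have hb : Continuous b :=
    continuous_const.mul ((hcs g₀).comp (Coinduced.continuous_truncate D x₀))
  have hlim : ∀ y : Coinduced L X, {q | y q ≠ x₀}.Finite →
      ∀ᶠ g in coKFinite K, (φ g)⁻¹ * c (g, y) = b y := by
    intro y hy
    filter_upwards [hCD hD, hCD (hy.sdiff (t := D))] with g hg hg'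
    -- Off `D` the increment at `g` equals the one at `1`, which is trivial.
    have h1 : c (g, Coinduced.truncate D x₀ y) = c (g, y) := by
      have := increment_eq_of_eq_off_finite hC hy.sdiff (Coinduced.truncate D x₀ y) y
        (fun q hq => ?_) hg' (g' := 1) (fun d hd => not_not.1 hd.2)
      · simpa [hone, inv_mul_eq_one] using this
      · by_cases h : q ∈ D
        · exact Coinduced.truncate_of_mem h _ _
        · rw [Coinduced.truncate_of_notMem h]
          by_contra hne
          exact hq ⟨Ne.symm hne, h⟩
    rw [← h1]
    exact increment_eq_of_eq_off_finite hC hD y₀ _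
      (fun q hq => (Coinduced.truncate_of_notMem hq _ _).symm) hg hg₀
  have hfinite : ∀ (s : G) (y : Coinduced L X), {q | y q ≠ x₀}.Finite →
      c (s, y) = (b (s • y))⁻¹ * φ s * b y := by
    intro s y hy
    obtain ⟨g, hg1, hg2⟩ := ((hlim _ (Coinduced.smul_eq_off_finite hx₀ hy s)).and
      ((tendsto_mul_right_coKFinite hKcomm s).eventually (hlim y hy))).exists
    rw [← hg1, ← hg2, hc.cocycle, map_mul]
    group
  refine ⟨φ, b, hb, fun s y => ?_⟩
  have hcont : Continuous fun y => (b (s • y))⁻¹ * φ s * b y :=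
    ((hb.comp (Coinduced.continuous_smul s)).inv.mul continuous_const).mul hb
  obtain ⟨F', hF', hdep⟩ := Coinduced.exists_finite_dependsOn hcont
  -- Both sides see only the coordinates in `F s ∪ F'`, so `y` may be replaced by a finitely
  -- supported configuration.
  let z := Coinduced.truncate (F s ∪ F') x₀ y
  have hz : ∀ q ∈ F s ∪ F', y q = z q := fun q hq => (Coinduced.truncate_of_mem hq _ _).symm
  rw [hFdep s y z fun q hq => hz q (.inl hq), hdep y z fun q hq => hz q (.inr hq)]
  refine hfinite s z (((hF s).union hF').subset fun q hq => ?_)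
  by_contra h
  exact hq (Coinduced.truncate_of_notMem h _ _)
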